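/- \textbf{Setting.} Fix bounds $n$ and $\Delta$. A network is a graph of maximum degree at most $\Delta$ whose vertices carry distinct IDs from a set of $n$ IDs. Computation proceeds in synchronous rounds; in each round every vertex receives the current memory contents of its neighbors and then updates its own memory. Between two rounds the adversary may arbitrarily change the memory (RAM) of any vertices (faults), remove or add vertices and change links (dynamic updates), as long as the bounds $n,\Delta$ are respected. An adversarial change of memory is a fault at that vertex; a crash or appearance is an update at that vertex; the creation or removal of a link between two vertices that are both present before and after is an update at both endpoints. \textbf{Algorithm.} Let $\mathcal A$ be a deterministic distributed vertex-coloring algorithm. Along with $\mathcal A$, every vertex $v$ keeps a status in $\{\mathrm{MIS},\mathrm{NOTMIS},\mathrm{Undecided}\}$, and in every round, from the statuses and colors at the start of the round: if $v$ has status MIS and a neighbor in MIS, it becomes Undecided; if $v$ has status NOTMIS and no neighbor in MIS, it becomes Undecided; if $v$ is Undecided and has a neighbor in MIS, it becomes NOTMIS; if $v$ is Undecided (or has just become Undecided from NOTMIS in this very round), has no neighbor in MIS, and its color is smaller than the colors of all its Undecided neighbors, it joins MIS. A state is \emph{stabilized} if the coloring is proper and no color changes any more in the absence of faults, no vertex is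 Undecided, and the vertices of status MIS form a maximal independent set. \textbf{Adjustment radius.} This is the maximum (supremum in $\mathbb N\cup\{\infty\}$), over all executions starting in a stabilized state (with arbitrary faults and updates, in any number and at any times) and all initially present vertices $v$ whose status at some later time differs from the initial one, of the distance of $v$ from the closest fault or update that has occurred by then; the distance from a fault or update is taken in the network right before or right after it, whichever is smaller, and is $\infty$ if there was none. \textbf{Theorem.} (1) For every $\mathcal A$, the adjustment radius of the MIS algorithm is at most $2$: starting from a stabilized state, only vertices within distance $2$ of a fault or update can ever change their status. (2) This is tight: if $n\ge 3$, $\Delta\ge 2$ and $\mathcal A$ is self-stabilizing (that is, there are $k$ and $T$ such that in every network, from arbitrary memory contents, $T$ rounds without faults lead to a proper coloring with colors $0,\dots,k-1$ that no longer changes; in particular if $k=O(\Delta)$), then the adjustment radius equals $2$. (3) Moreover, a fault at distance $2$ can make a vertex join the MIS: in a stabilized state, let $v$ have status NOTMIS, let $u$ be its only neighbor in MIS, let $w\neq v$ be a neighbor of $u$ that is not adjacent to $v$, and suppose that the color of $v$ is smaller than that of $u$. If a fault changes the status of $w$ to MIS and no other fault or update occurs, then after two rounds $v$ has status MIS. 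-/

import Mathlib

namespace SelfStabMIS

/-- The communication network in one round. Vertices are named by their unique IDs in `Fin n`
(`n` is the known bound on the number of vertices); `alive` is the set of vertices that are
currently present, and `Δ` is the known bound on the maximum degree. -/
structure Network (n Δ : ℕ) where
  alive : Set (Fin n)
  graph : SimpleGraph (Fin n)
  alive_of_adj : ∀ {u v : Fin n}, graph.Adj u v → u ∈ alive
  degree_le : ∀ v : Fin n, (graph.neighborSet v).ncard ≤ Δ

/-- A deterministic synchronous distributed algorithm that maintains a vertex coloring, for given
bounds `n` and `Δ` (which it may use). `Mem` is the part of the RAM that it uses and `color` reads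
the current color off it. In each round a vertex computes its new memory by `next` from its ID, its
own memory and what it has received: `some` of the memory of `u` from every neighbor `u`, and `none`
from every vertex that is not a neighbor. -/
structure ColoringAlgorithm (n Δ : ℕ) where
  Mem : Type
  mem_nonempty : Nonempty Mem
  color : Mem → ℕ
  next : Fin n → Mem → (Fin n → Option Mem) → Mem

namespace ColoringAlgorithm

variable {n Δ : ℕ}

open Classical in
/-- One synchronous round, without faults, of a coloring algorithm in the network `N`. -/
noncomputable def round (A : ColoringAlgorithm n Δ) (N : Network n Δ) (m : Fin n → A.Mem) :
    Fin n → A.Mem :=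
  fun v => A.next v (m v) (fun u => if N.graph.Adj v u then some (m u) else none)

/-- The coloring is proper, and no color changes any more as long as nothing fails. -/
def ColoringStable (A : ColoringAlgorithm n Δ) (N : Network n Δ) (m : Fin n → A.Mem) : Prop :=
  (∀ u v, N.graph.Adj u v → A.color (m u) ≠ A.color (m v)) ∧
  ∀ v ∈ N.alive, ∀ t : ℕ, A.color ((A.round N)^[t] m v) = A.color (m v)

/-- `A` is a self-stabilizing vertex-coloring algorithm with `k` colors: from arbitrary memory
contents, in every network that respects the bounds, after some bounded number `T` of rounds without
faults the coloring is proper, uses only the colors `0, …, k - 1`, and does not change any more. -/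
def IsSelfStabilizing (A : ColoringAlgorithm n Δ) (k : ℕ) : Prop :=
  ∃ T : ℕ, ∀ (N : Network n Δ) (m : Fin n → A.Mem),
    A.ColoringStable N ((A.round N)^[T] m) ∧
    ∀ v ∈ N.alive, A.color ((A.round N)^[T] m v) < k

end ColoringAlgorithm

/-- The MIS status of a vertex. -/
inductive Status where
  | mis
  | notMis
  | undecided

/-- The RAM of a vertex in the MIS algorithm run on top of the coloring algorithm `A`. -/
structure Ram {n Δ : ℕ} (A : ColoringAlgorithm n Δ) where
  mem : A.Mem
  status : Status

section Algorithm

variable {n Δ : ℕ} {A : ColoringAlgorithm n Δ}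

/-- Vertex `v` has a neighbor in the MIS. -/
def HasMisNeighbor (N : Network n Δ) (σ : Fin n → Ram A) (v : Fin n) : Prop :=
  ∃ u, N.graph.Adj v u ∧ (σ u).status = Status.mis

/-- The color of `v` is smaller than that of all its undecided neighbors. -/
def ColorMinimal (N : Network n Δ) (σ : Fin n → Ram A) (v : Fin n) : Prop :=
  ∀ u, N.graph.Adj v u → (σ u).status = Status.undecided →
    A.color (σ v).mem < A.color (σ u).mem

open Classical in
/-- The status that `v` computes in a round. A vertex of the MIS with a neighbor in the MIS becomes
undecided. A `notMis` vertex without neighbor in the MIS becomes undecided. An undecided vertex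
with a neighbor in the MIS becomes `notMis`; an undecided vertex (or one that becomes so from
`notMis` in this very round) without neighbor in the MIS, whose color is smaller than
that of all its undecided neighbors, joins the MIS. -/
noncomputable def nextStatus (N : Network n Δ) (σ : Fin n → Ram A) (v : Fin n) : Status :=
  match (σ v).status with
  | Status.mis =>
      if HasMisNeighbor N σ v then Status.undecided else Status.mis
  | Status.notMis =>
      if HasMisNeighbor N σ v then Status.notMis
      else if ColorMinimal N σ v then Status.mis else Status.undecided
  | Status.undecided =>
      if HasMisNeighbor N σ v then Status.notMis
      else if ColorMinimal N σ v then Status.mis else Status.undecided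

/-- One synchronous round, without faults, of the MIS algorithm: every vertex performs a step of the
coloring algorithm and a step of the status rule, both from the states at the start of the round. -/
noncomputable def misRound (N : Network n Δ) (σ : Fin n → Ram A) : Fin n → Ram A :=
  fun v => ⟨A.round N (fun u => (σ u).mem) v, nextStatus N σ v⟩

/-- The algorithm has stabilized in `N`: the coloring is stable, no vertex is undecided, and
the vertices of status `mis` form a maximal independent set of the network. -/
structure Stabilized (N : Network n Δ) (σ : Fin n → Ram A) : Prop where
  coloring : A.ColoringStable N (fun u => (σ u).mem)
  decided : ∀ v ∈ N.alive, (σ v).status ≠ Status.undecided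
  independent : ∀ u v, N.graph.Adj u v →
    ¬((σ u).status = Status.mis ∧ (σ v).status = Status.mis)
  maximal : ∀ v ∈ N.alive, (σ v).status ≠ Status.mis → HasMisNeighbor N σ v

/-- Vertex `x` experiences a fault or a dynamic update when network and memory contents change
from `(N, σ)` to `(N', σ')` between two rounds: `x` crashes or appears, or the RAM of `x` is altered,
or a link between `x` and another vertex that is present before and after is created or removed.
(The crash or appearance of a vertex is an update of that vertex only.) -/
def Touched (N : Network n Δ) (σ : Fin n → Ram A) (N' : Network n Δ) (σ' : Fin n → Ram A)
    (x : Fin n) : Prop :=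
  (x ∈ N.alive ∧ x ∉ N'.alive) ∨ (x ∉ N.alive ∧ x ∈ N'.alive) ∨
  (x ∈ N.alive ∧ x ∈ N'.alive ∧
    (σ x ≠ σ' x ∨
      ∃ u, u ∈ N.alive ∧ u ∈ N'.alive ∧ ¬(N.graph.Adj x u ↔ N'.graph.Adj x u)))

end Algorithm

/-- An execution in the fully dynamic setting with faults: `net t` and `ram t` are the network and
the memory contents at the start of round `t`. Between the end of round `t` and the start of round
`t + 1` the network and the memory contents may change arbitrarily. -/
structure Execution {n Δ : ℕ} (A : ColoringAlgorithm n Δ) where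
  net : ℕ → Network n Δ
  ram : ℕ → Fin n → Ram A

namespace Execution

variable {n Δ : ℕ} {A : ColoringAlgorithm n Δ}

/-- `x` experiences a fault or a dynamic update between round `t` and round `t + 1`. -/
def TouchedAt (E : Execution A) (t : ℕ) (x : Fin n) : Prop :=
  Touched (E.net t) (misRound (E.net t) (E.ram t)) (E.net (t + 1)) (E.ram (t + 1)) x

/-- The distance of `v` from the closest fault or dynamic update that occurs before round `t`
(`⊤` if there is none), where distances from a fault or update are taken in the
network right before or right after it, whichever is smaller. -/
noncomputable def distToFaults (E : Execution A) (t : ℕ) (v : Fin n) : ℕ∞ :=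
  ⨅ (s : ℕ) (_ : s < t) (x : Fin n) (_ : E.TouchedAt s x),
    min ((E.net s).graph.edist v x) ((E.net (s + 1)).graph.edist v x)

end Execution

/-- The adjustment radius of the MIS algorithm run on top of `A`: the maximum, over all executions
that start in a stabilized state and all vertices whose status at some later time differs
from the initial one, of the distance of the vertex from the closest fault or dynamic update that
has occurred by that time. -/
noncomputable def adjustmentRadius {n Δ : ℕ} (A : ColoringAlgorithm n Δ) : ℕ∞ :=
  sSup {d : ℕ∞ | ∃ (E : Execution A) (t : ℕ) (v : Fin n),
    Stabilized (E.net 0) (E.ram 0) ∧ v ∈ (E.net 0).alive ∧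
    (E.ram t v).status ≠ (E.ram 0 v).status ∧ d = E.distToFaults t v}

end SelfStabMIS

namespace SelfStabMIS

variable {n Δ : ℕ} {A : ColoringAlgorithm n Δ}

/-! Upper bound: an MIS vertex `u` and its neighbors, all NOTMIS, lock each other. `u` sees no MIS
vertex and stays; each neighbor sees `u` and stays. Neither colors nor anything outside the closed
neighborhood of `u` matter, so only faults or updates inside it can break the lock
(`status_of_untouchedAround`). In a stabilized state every vertex `v` lies in such a neighborhood,
centered at `v` or at an MIS neighbor of `v`, hence within distance 2 of `v`.

Lower bound: if a fault puts a second neighbor `w` of `u` into the MIS, then `u` becomes Undecided,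
and a vertex `v` relying on `u` alone must leave NOTMIS one round later (`ne_notMis_after_fault`).
On a path with its middle vertex in the MIS, this happens at distance 2 whatever the colors are. The
color of `v` only decides whether it joins the MIS at once. -/

theorem Network.alive_of_adj_right (N : Network n Δ) {u v : Fin n} (h : N.graph.Adj u v) :
    v ∈ N.alive :=
  N.alive_of_adj h.symm

theorem nextStatus_mis_of_not_hasMisNeighbor {N : Network n Δ} {σ : Fin n → Ram A} {v : Fin n}
    (h : (σ v).status = Status.mis) (h' : ¬ HasMisNeighbor N σ v) :
    nextStatus N σ v = Status.mis := by
  simp [nextStatus, h, h']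

theorem nextStatus_undecided_of_mis {N : Network n Δ} {σ : Fin n → Ram A} {v : Fin n}
    (h : (σ v).status = Status.mis) (h' : HasMisNeighbor N σ v) :
    nextStatus N σ v = Status.undecided := by
  simp [nextStatus, h, h']

theorem nextStatus_notMis_of_hasMisNeighbor {N : Network n Δ} {σ : Fin n → Ram A} {v : Fin n}
    (h : (σ v).status = Status.notMis) (h' : HasMisNeighbor N σ v) :
    nextStatus N σ v = Status.notMis := by
  simp [nextStatus, h, h']

/-- Every rule that yields NOTMIS requires an MIS neighbor. This is why tightness needs no
assumption on the order of the colors. -/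
theorem nextStatus_ne_notMis {N : Network n Δ} {σ : Fin n → Ram A} {v : Fin n}
    (h' : ¬ HasMisNeighbor N σ v) : nextStatus N σ v ≠ Status.notMis := by
  unfold nextStatus
  cases (σ v).status <;> by_cases hc : ColorMinimal N σ v <;> simp [h', hc]

theorem nextStatus_mis_of_colorMinimal {N : Network n Δ} {σ : Fin n → Ram A} {v : Fin n}
    (h' : ¬ HasMisNeighbor N σ v) (hc : ColorMinimal N σ v) :
    nextStatus N σ v = Status.mis := by
  unfold nextStatus
  cases (σ v).status <;> simp [h', hc]

theorem Status.eq_notMis {s : Status} (h : s ≠ Status.mis) (h' : s ≠ Status.undecided) :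
    s = Status.notMis := by
  cases s <;> simp_all

/-! ### Stabilized states and the effect of one fault on them -/

namespace Stabilized

variable {N : Network n Δ} {σ : Fin n → Ram A}

theorem not_hasMisNeighbor (h : Stabilized N σ) {v : Fin n} (hv : (σ v).status = Status.mis) :
    ¬ HasMisNeighbor N σ v := by
  rintro ⟨u, hu, hus⟩
  exact h.independent v u hu ⟨hv, hus⟩

theorem status_eq_notMis (h : Stabilized N σ) {v : Fin n} (hv : v ∈ N.alive)
    (hm : (σ v).status ≠ Status.mis) : (σ v).status = Status.notMis :=
  Status.eq_notMis hm (h.decided v hv)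

theorem notMis_of_adj_mis (h : Stabilized N σ) {u x : Fin n} (hu : (σ u).status = Status.mis)
    (hx : N.graph.Adj u x) : (σ x).status = Status.notMis :=
  h.status_eq_notMis (N.alive_of_adj_right hx) fun hm => h.independent u x hx ⟨hu, hm⟩

theorem nextStatus_eq (h : Stabilized N σ) {v : Fin n} (hv : v ∈ N.alive) :
    nextStatus N σ v = (σ v).status := by
  by_cases hm : (σ v).status = Status.mis
  · rw [nextStatus_mis_of_not_hasMisNeighbor hm (h.not_hasMisNeighbor hm), hm]
  · have hn := h.status_eq_notMis hv hm
    rw [nextStatus_notMis_of_hasMisNeighbor hn (h.maximal v hv hm), hn]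

theorem color_round (h : Stabilized N σ) {v : Fin n} (hv : v ∈ N.alive) :
    A.color (A.round N (fun u => (σ u).mem) v) = A.color (σ v).mem :=
  h.coloring.2 v hv 1

/-- A stabilized state remains stabilized in a round without faults. -/
theorem misRound (h : Stabilized N σ) : Stabilized N (misRound N σ) where
  coloring := by
    refine ⟨fun u v huv => ?_, fun v hv t => ?_⟩
    · have hu := h.color_round (N.alive_of_adj huv)
      have hv := h.color_round (N.alive_of_adj_right huv)
      change A.color (A.round N (fun u => (σ u).mem) u) ≠ A.color (A.round N (fun u => (σ u).mem) v)
      rw [hu, hv]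
      exact h.coloring.1 u v huv
    · exact (h.coloring.2 v hv (t + 1)).trans (h.color_round hv).symm
  decided v hv := by
    change nextStatus N σ v ≠ _
    rw [h.nextStatus_eq hv]
    exact h.decided v hv
  independent u v huv := by
    change ¬ (nextStatus N σ u = _ ∧ nextStatus N σ v = _)
    rw [h.nextStatus_eq (N.alive_of_adj huv), h.nextStatus_eq (N.alive_of_adj_right huv)]
    exact h.independent u v huv
  maximal v hv hm := by
    change nextStatus N σ v ≠ _ at hm
    rw [h.nextStatus_eq hv] at hm
    obtain ⟨u, hu, hus⟩ := h.maximal v hv hm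
    exact ⟨u, hu, (h.nextStatus_eq (N.alive_of_adj_right hu)).trans hus⟩

section Fault

variable {u v w : Fin n}

/-- The statuses around `v` one round after a vertex `w` at distance two of `v` has been put into
the MIS by a fault: the only MIS neighbor `u` of `v` becomes undecided, while the other neighbors
of `v` do not change. -/
theorem status_after_fault (h : Stabilized N σ) (hvu : N.graph.Adj v u) (huw : N.graph.Adj u w)
    (hvw : ¬ N.graph.Adj v w)
    (huniq : ∀ x, N.graph.Adj v x → ((σ x).status = Status.mis ↔ x = u))
    {x : Fin n} (hx : N.graph.Adj v x) :
    nextStatus N (Function.update σ w ⟨(σ w).mem, Status.mis⟩) x =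
      if x = u then Status.undecided else Status.notMis := by
  set τ := Function.update σ w ⟨(σ w).mem, Status.mis⟩ with hτ
  -- The fault only adds to the set of MIS vertices, so old MIS neighbors survive it.
  have hmis : ∀ y, (σ y).status = Status.mis → (τ y).status = Status.mis := by
    intro y hy
    by_cases hyw : y = w
    · subst hyw; simp [hτ]
    · simpa [hτ, hyw] using hy
  split_ifs with hxu
  · subst hxu
    exact nextStatus_undecided_of_mis (hmis x ((huniq x hx).2 rfl)) ⟨w, huw, by simp [hτ]⟩
  · have hxa := N.alive_of_adj_right hx
    have hxm : (σ x).status ≠ Status.mis := fun hm => hxu ((huniq x hx).1 hm)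
    -- Non-adjacency of `v` and `w` keeps the faulty vertex out of the neighborhood of `v`.
    have hxw : x ≠ w := fun e => hvw (e ▸ hx)
    refine nextStatus_notMis_of_hasMisNeighbor ?_ ?_
    · simpa [hτ, hxw] using h.status_eq_notMis hxa hxm
    · obtain ⟨y, hy, hys⟩ := h.maximal x hxa hxm
      exact ⟨y, hy, hmis y hys⟩

theorem not_hasMisNeighbor_after_fault (h : Stabilized N σ) (hvu : N.graph.Adj v u)
    (huw : N.graph.Adj u w) (hvw : ¬ N.graph.Adj v w)
    (huniq : ∀ x, N.graph.Adj v x → ((σ x).status = Status.mis ↔ x = u)) :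
    ¬ HasMisNeighbor N
      (SelfStabMIS.misRound N (Function.update σ w ⟨(σ w).mem, Status.mis⟩)) v := by
  rintro ⟨x, hx, hxs⟩
  have := h.status_after_fault hvu huw hvw huniq hx
  change nextStatus N _ x = _ at hxs
  rw [hxs] at this
  split_ifs at this

theorem ne_notMis_after_fault (h : Stabilized N σ) (hvu : N.graph.Adj v u)
    (huw : N.graph.Adj u w) (hvw : ¬ N.graph.Adj v w)
    (huniq : ∀ x, N.graph.Adj v x → ((σ x).status = Status.mis ↔ x = u)) :
    ((SelfStabMIS.misRound N)^[2] (Function.update σ w ⟨(σ w).mem, Status.mis⟩) v).status ≠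
      Status.notMis :=
  nextStatus_ne_notMis (h.not_hasMisNeighbor_after_fault hvu huw hvw huniq)

theorem mis_after_fault (h : Stabilized N σ) (hvu : N.graph.Adj v u)
    (huw : N.graph.Adj u w) (hvw : ¬ N.graph.Adj v w)
    (huniq : ∀ x, N.graph.Adj v x → ((σ x).status = Status.mis ↔ x = u))
    (hcol : A.color (σ v).mem < A.color (σ u).mem) :
    ((SelfStabMIS.misRound N)^[2] (Function.update σ w ⟨(σ w).mem, Status.mis⟩) v).status =
      Status.mis := by
  refine nextStatus_mis_of_colorMinimal (h.not_hasMisNeighbor_after_fault hvu huw hvw huniq) ?_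
  intro x hx hxs
  have hst := h.status_after_fault hvu huw hvw huniq hx
  change nextStatus N _ x = _ at hxs
  rw [hxs] at hst
  -- After the first round `u` is the only Undecided neighbor of `v`, so color minimality is a
  -- single comparison.
  have hxu : x = u := by
    by_contra hne
    simp [hne] at hst
  subst hxu
  -- The fault alters a status only; the coloring algorithm runs as in the stabilized state, where
  -- colors are constant.
  have hmem : (fun y => (Function.update σ w ⟨(σ w).mem, Status.mis⟩ y).mem) =
      fun y => (σ y).mem := by
    funext y
    by_cases hyw : y = w
    · subst hyw; simp
    · simp [hyw]
  change A.color (A.round N (fun y => (Function.update σ w ⟨(σ w).mem, Status.mis⟩ y).mem) v) <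
    A.color (A.round N (fun y => (Function.update σ w ⟨(σ w).mem, Status.mis⟩ y).mem) x)
  rw [hmem, h.color_round (N.alive_of_adj hvu), h.color_round (N.alive_of_adj_right hvu)]
  exact hcol

end Fault

end Stabilized

/-! ### What faults and updates elsewhere leave unchanged -/

section Untouched

variable {N N' : Network n Δ} {σ σ' : Fin n → Ram A} {x y : Fin n}

theorem alive_iff_of_not_touched (h : ¬ Touched N σ N' σ' x) : x ∈ N.alive ↔ x ∈ N'.alive := by
  unfold Touched at h
  tauto

theorem eq_of_not_touched (h : ¬ Touched N σ N' σ' x) (hx : x ∈ N.alive) : σ' x = σ x := by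
  have := alive_iff_of_not_touched h
  unfold Touched at h
  by_contra hne
  exact h (Or.inr (Or.inr ⟨hx, this.1 hx, Or.inl (Ne.symm hne)⟩))

/-- Both endpoints are needed: a link may vanish or appear through the crash or appearance of `y`,
which does not touch `x`. -/
theorem adj_iff_of_not_touched (hx : ¬ Touched N σ N' σ' x)
    (hy : N.graph.Adj x y ∨ N'.graph.Adj x y → ¬ Touched N σ N' σ' y) :
    N.graph.Adj x y ↔ N'.graph.Adj x y := by
  by_contra hne
  have hor : N.graph.Adj x y ∨ N'.graph.Adj x y := by tauto
  have hax := alive_iff_of_not_touched hx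
  have hay := alive_iff_of_not_touched (hy hor)
  have hx1 : x ∈ N.alive := hor.elim N.alive_of_adj fun e => hax.2 (N'.alive_of_adj e)
  have hy1 : y ∈ N.alive :=
    hor.elim N.alive_of_adj_right fun e => hay.2 (N'.alive_of_adj_right e)
  exact hx (Or.inr (Or.inr ⟨hx1, hax.1 hx1, Or.inr ⟨y, hy1, hay.1 hy1, hne⟩⟩))

end Untouched

namespace Execution

variable {E : Execution A} {t : ℕ} {u v : Fin n}

/-- Before round `t`, neither `u` nor any vertex that is a neighbor of `u` right before or right
after experiences a fault or an update. -/
def UntouchedAround (E : Execution A) (t : ℕ) (u : Fin n) : Prop :=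
  ∀ s < t, ¬ E.TouchedAt s u ∧ ∀ x, (E.net s).graph.Adj u x ∨ (E.net (s + 1)).graph.Adj u x →
    ¬ E.TouchedAt s x

theorem adj_iff_of_untouchedAround (h : E.UntouchedAround t u) {s : ℕ} (hs : s ≤ t) (x : Fin n) :
    (E.net s).graph.Adj u x ↔ (E.net 0).graph.Adj u x := by
  induction s with
  | zero => rfl
  | succ s ih =>
    rw [← ih (by omega)]
    exact (adj_iff_of_not_touched (h s hs).1 ((h s hs).2 x)).symm

theorem alive_iff_of_not_touchedAt (h : ∀ s < t, ¬ E.TouchedAt s u) {s : ℕ} (hs : s ≤ t) :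
    u ∈ (E.net s).alive ↔ u ∈ (E.net 0).alive := by
  induction s with
  | zero => rfl
  | succ s ih =>
    rw [← ih (by omega)]
    exact (alive_iff_of_not_touched (h s hs)).symm

/-- A vertex of the MIS, none of whose neighbors is in the MIS, keeps this property as long as all
faults and updates keep away from it and its neighbors. -/
theorem status_of_untouchedAround (h : E.UntouchedAround t u) (hu : u ∈ (E.net 0).alive)
    (hum : (E.ram 0 u).status = Status.mis)
    (hnb : ∀ x, (E.net 0).graph.Adj u x → (E.ram 0 x).status = Status.notMis)
    {s : ℕ} (hs : s ≤ t) :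
    (E.ram s u).status = Status.mis ∧
      ∀ x, (E.net 0).graph.Adj u x → (E.ram s x).status = Status.notMis := by
  induction s with
  | zero => exact ⟨hum, hnb⟩
  | succ s ih =>
    obtain ⟨ihu, ihn⟩ := ih (by omega)
    have hadj := E.adj_iff_of_untouchedAround h (s := s) (by omega)
    constructor
    · have hau : u ∈ (E.net s).alive :=
        (alive_iff_of_not_touchedAt (fun r hr => (h r hr).1) (by omega)).2 hu
      rw [eq_of_not_touched (h s hs).1 hau]
      refine nextStatus_mis_of_not_hasMisNeighbor ihu ?_
      rintro ⟨x, hx, hxs⟩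
      rw [ihn x ((hadj x).1 hx)] at hxs
      cases hxs
    · intro x hx
      have hxs := (hadj x).2 hx
      rw [eq_of_not_touched ((h s hs).2 x (Or.inl hxs)) ((E.net s).alive_of_adj_right hxs)]
      exact nextStatus_notMis_of_hasMisNeighbor (ihn x hx) ⟨u, hxs.symm, ihu⟩

theorem lt_edist_of_lt_distToFaults {d : ℕ∞} (h : d < E.distToFaults t v) {s : ℕ} (hs : s < t)
    {x : Fin n} (hx : E.TouchedAt s x) :
    d < (E.net s).graph.edist v x ∧ d < (E.net (s + 1)).graph.edist v x := by
  rw [← lt_min_iff]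
  exact h.trans_le (iInf₂_le_of_le s hs (iInf₂_le x hx))

theorem status_eq_of_two_lt_distToFaults (h0 : Stabilized (E.net 0) (E.ram 0))
    (hv : v ∈ (E.net 0).alive) (h : 2 < E.distToFaults t v) :
    (E.ram t v).status = (E.ram 0 v).status := by
  -- Distance to faults becomes a bound on walks in either network, so a short explicit walk to a
  -- touched vertex is a contradiction.
  have hwalk : ∀ s < t, ∀ x, E.TouchedAt s x → ∀ r, r = s ∨ r = s + 1 →
      ∀ p : (E.net r).graph.Walk v x, 2 < p.length := by
    intro s hs x hx r hr p
    have hd := E.lt_edist_of_lt_distToFaults h hs hx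
    have : (2 : ℕ∞) < (E.net r).graph.edist v x := by
      rcases hr with rfl | rfl
      exacts [hd.1, hd.2]
    exact_mod_cast this.trans_le p.edist_le
  have hself : E.UntouchedAround t v := by
    refine fun s hs => ⟨fun hx => ?_, fun x hadj hx => ?_⟩
    · simpa using hwalk s hs v hx s (Or.inl rfl) .nil
    · rcases hadj with hadj | hadj
      · simpa using hwalk s hs x hx s (Or.inl rfl) hadj.toWalk
      · simpa using hwalk s hs x hx (s + 1) (Or.inr rfl) hadj.toWalk
  by_cases hm : (E.ram 0 v).status = Status.mis
  · rw [hm]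
    exact (E.status_of_untouchedAround hself hv hm (fun x hx => h0.notMis_of_adj_mis hm hx)
      le_rfl).1
  · obtain ⟨u, hvu, hu⟩ := h0.maximal v hv hm
    -- Here the radius 2 arises: neighbors of `u` are reached from `v` through `u`, and the link
    -- from `v` to `u` is present both before and after each change.
    have hnb : E.UntouchedAround t u := by
      refine fun s hs => ?_
      have hadj : (E.net s).graph.Adj v u :=
        (E.adj_iff_of_untouchedAround hself hs.le u).2 hvu
      have hadj' : (E.net (s + 1)).graph.Adj v u :=
        (E.adj_iff_of_untouchedAround hself hs u).2 hvu
      refine ⟨(hself s hs).2 u (Or.inl hadj), fun x hx ht => ?_⟩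
      rcases hx with hx | hx
      · simpa using hwalk s hs x ht s (Or.inl rfl) (.cons hadj hx.toWalk)
      · simpa using hwalk s hs x ht (s + 1) (Or.inr rfl) (.cons hadj' hx.toWalk)
    have := (E.status_of_untouchedAround hnb ((E.net 0).alive_of_adj_right hvu) hu
      (fun x hx => h0.notMis_of_adj_mis hu hx) le_rfl).2 v hvu.symm
    rw [this, h0.status_eq_notMis hv hm]

end Execution

theorem adjustmentRadius_le_two (A : ColoringAlgorithm n Δ) : adjustmentRadius A ≤ 2 := by
  refine sSup_le ?_
  rintro d ⟨E, t, v, h0, hv, hne, rfl⟩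
  by_contra hlt
  exact hne (E.status_eq_of_two_lt_distToFaults h0 hv (not_le.1 hlt))

/-! ### Tightness: a single fault at distance two -/

/-- The execution from `σ` in the static network `N` whose only fault puts `w` into the MIS after
the first round. -/
noncomputable def singleFaultExecution (N : Network n Δ) (σ : Fin n → Ram A) (w : Fin n) :
    Execution A where
  net _ := N
  ram
    | 0 => σ
    | t + 1 => (misRound N)^[t]
        (Function.update (misRound N σ) w ⟨(misRound N σ w).mem, Status.mis⟩)

theorem eq_of_touchedAt_singleFaultExecution {N : Network n Δ} {σ : Fin n → Ram A} {w x : Fin n}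
    {s : ℕ} (h : (singleFaultExecution N σ w).TouchedAt s x) : x = w := by
  by_contra hne
  have hram : misRound N ((singleFaultExecution N σ w).ram s) x =
      (singleFaultExecution N σ w).ram (s + 1) x := by
    cases s with
    | zero => simp [singleFaultExecution, hne]
    | succ s => simp only [singleFaultExecution, Function.iterate_succ_apply']
  rcases h with h | h | ⟨-, -, h | ⟨u, -, -, h⟩⟩
  · exact h.2 h.1
  · exact h.1 h.2
  · exact h hram
  · exact h Iff.rfl

theorem two_le_edist_of_not_adj {V : Type*} {G : SimpleGraph V} {v w : V} (hne : v ≠ w)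
    (hadj : ¬ G.Adj v w) : 2 ≤ G.edist v w := by
  have h0 : G.edist v w ≠ 0 := by simpa [SimpleGraph.edist_eq_zero_iff] using hne
  have h1 : G.edist v w ≠ 1 := by simpa [SimpleGraph.edist_eq_one_iff_adj] using hadj
  generalize G.edist v w = d at *
  induction d with
  | top => exact le_top
  | coe d =>
    norm_cast at *
    omega

theorem two_le_adjustmentRadius_of_stabilized {N : Network n Δ} {σ : Fin n → Ram A}
    {u v w : Fin n} (h : Stabilized N σ) (hvu : N.graph.Adj v u) (huw : N.graph.Adj u w)
    (hne : v ≠ w) (hvw : ¬ N.graph.Adj v w) (hv : (σ v).status = Status.notMis)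
    (huniq : ∀ x, N.graph.Adj v x → ((σ x).status = Status.mis ↔ x = u)) :
    2 ≤ adjustmentRadius A := by
  let E := singleFaultExecution N σ w
  have hd : 2 ≤ E.distToFaults 3 v := by
    refine le_iInf₂ fun s _ => le_iInf₂ fun x hx => ?_
    obtain rfl := eq_of_touchedAt_singleFaultExecution hx
    exact le_min (two_le_edist_of_not_adj hne hvw) (two_le_edist_of_not_adj hne hvw)
  refine hd.trans (le_sSup ⟨E, 3, v, h, N.alive_of_adj hvu, ?_, rfl⟩)
  change ((misRound N)^[2] _ v).status ≠ (σ v).status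
  rw [hv]
  -- The earliest possible fault follows one faultless round, so it hits the still stabilized
  -- `misRound N σ`; time 3 is two rounds later.
  refine h.misRound.ne_notMis_after_fault hvu huw hvw fun x hx => ?_
  change nextStatus N σ x = _ ↔ _
  rw [h.nextStatus_eq (N.alive_of_adj_right hx)]
  exact huniq x hx

/-- The network that consists of the path `a`, `b`, `c`. -/
def pathNetwork (hΔ : 2 ≤ Δ) (a b c : Fin n) (hab : a ≠ b) (hcb : c ≠ b) : Network n Δ where
  alive := {a, b, c}
  graph :=
    { Adj := fun x y => (x = b ∧ (y = a ∨ y = c)) ∨ (y = b ∧ (x = a ∨ x = c))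
      symm := ⟨fun _ _ h => h.symm⟩
      loopless := ⟨by rintro x (⟨rfl, h | h⟩ | ⟨rfl, h | h⟩) <;> simp_all⟩ }
  alive_of_adj := by
    rintro u v (⟨rfl, -⟩ | ⟨-, rfl | rfl⟩) <;> simp
  degree_le v := by
    refine le_trans ?_ hΔ
    by_cases hv : v = b
    · refine (Set.ncard_le_ncard (t := {a, c}) ?_ (Set.toFinite _)).trans
        ((Set.ncard_insert_le a {c}).trans (by simp))
      rintro x (⟨-, hx⟩ | ⟨rfl, hx⟩)
      · simpa using hx
      · simp_all
    · refine (Set.ncard_le_ncard (t := {b}) ?_ (Set.toFinite _)).trans (by simp)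
      rintro x (⟨rfl, -⟩ | ⟨rfl, -⟩) <;> simp_all

theorem two_le_adjustmentRadius (hn : 3 ≤ n) (hΔ : 2 ≤ Δ) {k : ℕ} (hA : A.IsSelfStabilizing k) :
    2 ≤ adjustmentRadius A := by
  classical
  obtain ⟨a, b, c, hab, hac, hbc⟩ : ∃ a b c : Fin n, a ≠ b ∧ a ≠ c ∧ b ≠ c :=
    ⟨⟨0, by omega⟩, ⟨1, by omega⟩, ⟨2, by omega⟩, by simp, by simp, by simp⟩
  obtain ⟨T, hT⟩ := hA
  obtain ⟨m₀⟩ := A.mem_nonempty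
  let N : Network n Δ := pathNetwork hΔ a b c hab hbc.symm
  have hadj : ∀ x y, N.graph.Adj x y ↔
      (x = b ∧ (y = a ∨ y = c)) ∨ (y = b ∧ (x = a ∨ x = c)) := fun _ _ => Iff.rfl
  -- Running the coloring algorithm for `T` rounds from arbitrary memory supplies a stable coloring;
  -- the statuses are chosen by hand.
  let σ : Fin n → Ram A := fun x =>
    ⟨(A.round N)^[T] (fun _ => m₀) x, if x = b then Status.mis else Status.notMis⟩
  have hmis : ∀ x, (σ x).status = Status.mis ↔ x = b := by
    intro x
    by_cases hx : x = b <;> simp [σ, hx]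
  have hσ : Stabilized N σ :=
    { coloring := (hT N fun _ => m₀).1
      decided := by
        intro x _
        by_cases hx : x = b <;> simp [σ, hx]
      independent := by
        intro x y hxy hm
        rw [hmis, hmis] at hm
        obtain ⟨rfl, rfl⟩ := hm
        exact hxy.ne rfl
      maximal := by
        intro x hx hm
        rw [Ne, hmis] at hm
        refine ⟨b, (hadj _ _).2 (Or.inr ⟨rfl, ?_⟩), (hmis b).2 rfl⟩
        rcases hx with rfl | rfl | rfl
        exacts [Or.inl rfl, absurd rfl hm, Or.inr rfl] }
  refine two_le_adjustmentRadius_of_stabilized (u := b) (v := a) (w := c) hσ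
    ((hadj _ _).2 (by simp)) ((hadj _ _).2 (by simp)) hac ?_ (by simp [σ, hab])
    fun x _ => hmis x
  rw [hadj]
  rintro (⟨h, -⟩ | ⟨h, -⟩)
  exacts [hab h, hbc h.symm]

end SelfStabMIS

open SelfStabMIS in
theorem mainTheorem9 {n Δ : ℕ} (A : ColoringAlgorithm n Δ) :
    -- the upper bound
    adjustmentRadius A ≤ 2 ∧
    -- the exact value
    (3 ≤ n → 2 ≤ Δ → (∃ k : ℕ, A.IsSelfStabilizing k) → adjustmentRadius A = 2) ∧
    -- a fault at distance two can make a vertex join the MIS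
    (∀ (N : Network n Δ) (σ : Fin n → Ram A) (u v w : Fin n),
      Stabilized N σ → N.graph.Adj v u → N.graph.Adj u w → v ≠ w → ¬ N.graph.Adj v w →
      (σ v).status = Status.notMis →
      (∀ x, N.graph.Adj v x → ((σ x).status = Status.mis ↔ x = u)) →
      A.color (σ v).mem < A.color (σ u).mem →
      ((misRound N)^[2] (Function.update σ w ⟨(σ w).mem, Status.mis⟩) v).status = Status.mis) := by
  refine ⟨adjustmentRadius_le_two A, ?_, ?_⟩
  · rintro hn hΔ ⟨k, hA⟩
    exact le_antisymm (adjustmentRadius_le_two A) (two_le_adjustmentRadius hn hΔ hA)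
  · intro N σ u v w h hvu huw _ hvw _ huniq hcol
    exact h.mis_after_fault hvu huw hvw huniq hcol
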